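/- Let $\mathbb{F}$ be the binary field and let $\mathbf{e}$ and $\mathbf{u}$ be the all-zero and the all-one word. For $\pi\in S_n$ and $x\in\mathbb{F}^n$ put $\pi(x)=(x_{\pi^{-1}(1)},\dots,x_{\pi^{-1}(n)})$. A (binary) Hadamard code of length $n$ consists of the rows of a binary Hadamard matrix of order $n$ (each $1$ replaced by $0$ and each $-1$ by $1$) together with their complements. A propelinear code of length $n$ is a set $C\subseteq\mathbb{F}^n$ with $\mathbf{e}\in C$, together with a permutation $\pi_x\in S_n$ for each $x\in C$, such that for all $x,y\in C$ one has $x+\pi_x(y)\in C$ and $\pi_x\pi_y=\pi_{x+\pi_x(y)}$; then $C$ is a group under $x*y=x+\pi_x(y)$. A Hadamard full propelinear code (HFP-code) is a propelinear code $C$ which is a Hadamard code and for which $\pi_{\mathbf{e}}=\pi_{\mathbf{u}}=I$ and $\pi_a$ has no fixed coordinate for every $a\in C\setminus\{\mathbf{e},\mathbf{u}\}$. An $\operatorname{HFP}(4t_{\mathbf{u}},2)$-code is an HFP-code of length $4t$ whose group is $C_{4t}\times C_2=\langle a\rangle\times\langle b\rangle$, with $a$ of order $4t$, $b$ of order $2$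 and $a^{2t}=\mathbf{u}$. The kernel of $C$ is the linear subspace $K(C)=\{z\in\mathbb{F}^n : C+z=C\}$. **Theorem.** Let $t\ge 4$ and let $C$ be an $\operatorname{HFP}(4t_{\mathbf{u}},2)$-code. Then $\dim K(C)=1$. -/

import Mathlib

/-- Binary words of length `n`. -/
abbrev Word (n : ℕ) : Type := Fin n → ZMod 2

namespace Word

/-- The action of coordinate permutations on words,
`π (x₁, …, xₙ) = (x_{π⁻¹ 1}, …, x_{π⁻¹ n})`. -/
def permute {n : ℕ} (σ : Equiv.Perm (Fin n)) (x : Word n) : Word n := fun i => x (σ⁻¹ i)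

theorem permute_one {n : ℕ} (x : Word n) : permute 1 x = x := rfl

theorem permute_mul {n : ℕ} (σ τ : Equiv.Perm (Fin n)) (x : Word n) :
    permute (σ * τ) x = permute σ (permute τ x) := by
  funext i; simp [permute, mul_inv_rev]

theorem permute_add {n : ℕ} (σ : Equiv.Perm (Fin n)) (x y : Word n) :
    permute σ (x + y) = permute σ x + permute σ y := rfl

end Word

/-- The kernel `K(C) = {z : C + z = C}` of a binary code `C`, as a linear subspace. -/
def codeKernel {n : ℕ} (C : Set (Word n)) : Submodule (ZMod 2) (Word n) where
  carrier := {z | (fun x => x + z) '' C = C}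
  zero_mem' := by simp
  add_mem' := by
    intro z w hz hw
    simp only [Set.mem_ofPred_eq] at *
    have : (fun x : Word n => x + (z + w)) = (fun x => x + w) ∘ (fun x => x + z) := by
      funext x; simp [add_assoc]
    rw [this, Set.image_comp, hz, hw]
  smul_mem' := by
    intro c z hz
    have hc : c = 0 ∨ c = 1 := by revert c; decide
    rcases hc with rfl | rfl
    · simp
    · simpa using hz

/-- The row `i` of the binary matrix obtained from a `±1` matrix `H`
by replacing each `1` by `0` and each `-1` by `1`. -/
def binaryRow {n : ℕ} (H : Matrix (Fin n) (Fin n) ℤ) (i : Fin n) : Word n :=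
  fun j => if H i j = 1 then 0 else 1

/-- A Hadamard code: the rows of a binary Hadamard matrix and their complements. -/
def IsHadamardCode {n : ℕ} (C : Set (Word n)) : Prop :=
  ∃ H : Matrix (Fin n) (Fin n) ℤ, H.IsHadamard ∧
    C = {x | ∃ i, x = binaryRow H i ∨ x = binaryRow H i + 1}

/-- A binary code of length `n` containing the all-zero word, with a propelinear structure:
a permutation `π x` for each codeword `x` such that `x + π x (y)` is a codeword and
`π x ∘ π y = π (x + π x (y))` for all codewords `x`, `y`. -/
structure PropelinearCode (n : ℕ) where
  /-- the set of codewords -/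
  carrier : Set (Word n)
  zero_mem : (0 : Word n) ∈ carrier
  /-- the permutation associated with a codeword -/
  π : carrier → Equiv.Perm (Fin n)
  add_permute_mem : ∀ x y : carrier, x.1 + Word.permute (π x) y.1 ∈ carrier
  π_mul : ∀ x y : carrier,
    π x * π y = π ⟨x.1 + Word.permute (π x) y.1, add_permute_mem x y⟩

namespace PropelinearCode

variable {n : ℕ} (C : PropelinearCode n)

theorem π_zero : C.π ⟨0, C.zero_mem⟩ = 1 := by
  have h := C.π_mul ⟨0, C.zero_mem⟩ ⟨0, C.zero_mem⟩
  have e : (⟨(0 : Word n) + Word.permute (C.π ⟨0, C.zero_mem⟩) 0,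
      C.add_permute_mem ⟨0, C.zero_mem⟩ ⟨0, C.zero_mem⟩⟩ : C.carrier) = ⟨0, C.zero_mem⟩ :=
    Subtype.ext (by funext i; simp [Word.permute])
  rw [e] at h
  exact mul_eq_left.mp h

theorem exists_right_inv (x : C.carrier) :
    ∃ y : C.carrier, x.1 + Word.permute (C.π x) y.1 = 0 := by
  have hinj : Function.Injective
      (fun y : C.carrier =>
        (⟨x.1 + Word.permute (C.π x) y.1, C.add_permute_mem x y⟩ : C.carrier)) := by
    intro y z h
    have h1 := add_left_cancel (congrArg Subtype.val h)
    apply Subtype.ext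
    funext i
    simpa [Word.permute] using congrFun h1 (C.π x i)
  obtain ⟨y, hy⟩ := Finite.surjective_of_injective hinj ⟨0, C.zero_mem⟩
  exact ⟨y, congrArg Subtype.val hy⟩

theorem inv_mem (x : C.carrier) : Word.permute (C.π x)⁻¹ x.1 ∈ C.carrier := by
  obtain ⟨y, hy⟩ := C.exists_right_inv x
  have h : x.1 = Word.permute (C.π x) y.1 := by
    have := eq_neg_of_add_eq_zero_left hy
    rwa [ZModModule.neg_eq_self] at this
  rw [h, ← Word.permute_mul, inv_mul_cancel, Word.permute_one]
  exact y.2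

/-- The group structure on the codewords, `x * y = x + π x (y)`, with identity the all-zero word
and `x⁻¹ = (π x)⁻¹ (x)`. -/
instance : Group C.carrier where
  mul x y := ⟨x.1 + Word.permute (C.π x) y.1, C.add_permute_mem x y⟩
  one := ⟨0, C.zero_mem⟩
  inv x := ⟨Word.permute (C.π x)⁻¹ x.1, C.inv_mem x⟩
  mul_assoc x y z := by
    apply Subtype.ext
    change (x.1 + Word.permute (C.π x) y.1) + Word.permute (C.π ⟨_, _⟩) z.1 =
      x.1 + Word.permute (C.π x) (y.1 + Word.permute (C.π y) z.1)
    rw [← C.π_mul, Word.permute_mul, Word.permute_add, add_assoc]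
  one_mul x := by
    apply Subtype.ext
    change (0 : Word n) + Word.permute (C.π ⟨0, C.zero_mem⟩) x.1 = x.1
    rw [C.π_zero, Word.permute_one, zero_add]
  mul_one x := by
    apply Subtype.ext
    change x.1 + Word.permute (C.π x) 0 = x.1
    funext i
    simp [Word.permute]
  inv_mul_cancel x := by
    apply Subtype.ext
    change Word.permute (C.π x)⁻¹ x.1 +
      Word.permute (C.π ⟨Word.permute (C.π x)⁻¹ x.1, C.inv_mem x⟩) x.1 = 0
    have key : C.π ⟨Word.permute (C.π x)⁻¹ x.1, C.inv_mem x⟩ = (C.π x)⁻¹ := by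
      have h := C.π_mul x ⟨Word.permute (C.π x)⁻¹ x.1, C.inv_mem x⟩
      have e : (⟨x.1 + Word.permute (C.π x) (Word.permute (C.π x)⁻¹ x.1),
          C.add_permute_mem x ⟨_, C.inv_mem x⟩⟩ : C.carrier) = ⟨0, C.zero_mem⟩ := by
        apply Subtype.ext
        change x.1 + Word.permute (C.π x) (Word.permute (C.π x)⁻¹ x.1) = 0
        rw [← Word.permute_mul, mul_inv_cancel, Word.permute_one, ZModModule.add_self]
      rw [e, C.π_zero] at h
      exact (inv_eq_of_mul_eq_one_right h).symm
    rw [key, ZModModule.add_self]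

/-- A Hadamard full propelinear (HFP) code: a Hadamard propelinear code in which `π a` has no
fixed coordinate for every codeword `a` other than the all-zero word `0` and the all-one word `1`,
while `π a` is the identity for these two words. -/
structure IsHFP : Prop where
  hadamard : IsHadamardCode C.carrier
  no_fixed : ∀ a : C.carrier, a.1 ≠ 0 → a.1 ≠ 1 → ∀ i, C.π a i ≠ i
  eq_one : ∀ a : C.carrier, a.1 = 0 ∨ a.1 = 1 → C.π a = 1

end PropelinearCode

/-- An HFP(4t_u, 2)-code: an HFP code of length `4 * t` whose group is `C_{4t} × C_2`, generated
by `a` of order `4t` and `b` of order `2`, where `a ^ (2 * t)` is the all-one word `u`. -/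
structure PropelinearCode.IsHFP4tu2 (t : ℕ) (C : PropelinearCode (4 * t)) : Prop
    extends C.IsHFP where
  groupType : ∃ φ : Multiplicative (ZMod (4 * t)) × Multiplicative (ZMod 2) ≃* C.carrier,
    (φ (Multiplicative.ofAdd 1, 1) ^ (2 * t)).1 = (1 : Word (4 * t))

/-! Fix a coordinate k and let F(g) be the sign of the k-th coordinate of the codeword g. Only e and
u have permutations with fixed coordinates, so π_g⁻¹(k) meets every coordinate exactly once as g
runs over a transversal of ⟨u⟩. The balance of the codewords thus becomes orthogonality of F to its
translates (`isOrthogonalSign`).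

The kernel is a 2-group stable under all π_g. If it exceeds {e, u}, it contains some z outside {e,
u} with z² in {e, u} (`exists_mul_self_mem`), and each π_g(z) lies in the kernel and has the same
square as z (`permute_mul_self`). With z = b whenever b is in the kernel, the few square roots
available in C_{4t} × C_2 force π_g(z) to be z or its complement. Hence F(gz) = c χ(g) F(g) for a
sign c and a ±1-valued character χ (`exists_translate_eq`).

Up to a factor u, z is b, a^t or a^t b; these are excluded by `not_translate_involution` and
`not_translate_square_root`. Depending on χ(a) and χ(b), the relation contradicts orthogonality or
the value of χ(z) at once, or produces a negacyclic Hadamard matrix of order t or 2t, or (t odd) two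
sums of signs with equal products. The last two are impossible modulo 4, because a sum of signs is
determined modulo 4 by their number and product. -/

/-- A `±1` valued function on a commutative group, odd under the translation by `a ^ m`, whose
translates by the elements of the group outside `{1, a ^ m}` are orthogonal to it on the
transversal `{a ^ i, a ^ i * b : i < m}`. -/
structure IsOrthogonalSign {M : Type*} [CommGroup M] (m : ℕ) (a b : M) (F : M → ℤ) : Prop where
  sq : ∀ g, F g * F g = 1
  neg : ∀ g, F (g * a ^ m) = -F g
  b_sq : b * b = 1
  orth : ∀ y, y ≠ 1 → y ≠ a ^ m →
    ∑ i ∈ Finset.range m, (F (a ^ i) * F (a ^ i * y) + F (a ^ i * b) * F (a ^ i * b * y)) = 0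
  pow_ne : ∀ k, 0 < k → k < m → a ^ k ≠ 1 ∧ a ^ k ≠ a ^ m
  pow_mul_ne : ∀ k < m, a ^ k * b ≠ 1 ∧ a ^ k * b ≠ a ^ m

/-! ### Sums and products of signs; negacyclic sequences -/

theorem Int.eq_one_or_neg_one_of_mul_self {x : ℤ} (h : x * x = 1) : x = 1 ∨ x = -1 :=
  mul_self_eq_one_iff.mp h

/-- A sum of `k` signs is determined modulo `4` by their product. -/
theorem four_dvd_sum_signs_sub {ι : Type*} (s : Finset ι) (f : ι → ℤ) (hf : ∀ i, f i * f i = 1) :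
    (∏ i ∈ s, f i) * (∏ i ∈ s, f i) = 1 ∧
      (4 : ℤ) ∣ (∑ i ∈ s, f i) - (s.card - 1 + ∏ i ∈ s, f i) := by
  classical
  induction s using Finset.induction_on with
  | empty => simp
  | insert i s hi ih =>
    obtain ⟨h1, h2⟩ := ih
    rw [Finset.sum_insert hi, Finset.prod_insert hi, Finset.card_insert_of_notMem hi]
    push_cast
    rcases Int.eq_one_or_neg_one_of_mul_self (hf i) with h | h <;>
      rcases Int.eq_one_or_neg_one_of_mul_self h1 with h' | h' <;>
      rw [h'] at h2 <;> rw [h, h'] <;> refine ⟨by norm_num, by omega⟩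

/-- The product of the quotients of a sequence of signs telescopes. -/
theorem prod_mul_succ_signs (p : ℕ → ℤ) (hp : ∀ i, p i * p i = 1) (m : ℕ) :
    ∏ i ∈ Finset.range m, p i * p (i + 1) = p 0 * p m := by
  induction m with
  | zero => simp [hp]
  | succ m ih =>
    rw [Finset.prod_range_succ, ih]
    linear_combination p 0 * p (m + 1) * hp m

/-- The telescoping product applied to the signs p_i p_{i+1}, since p_{i+1}² = 1. -/
theorem prod_mul_add_two_signs (p : ℕ → ℤ) (hp : ∀ i, p i * p i = 1) (m : ℕ) :
    ∏ i ∈ Finset.range m, p i * p (i + 2) = p 0 * p 1 * (p m * p (m + 1)) := by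
  have h := prod_mul_succ_signs (fun i => p i * p (i + 1))
    (fun i => by linear_combination p (i+1) * p (i+1) * hp i + hp (i+1)) m
  simp only [zero_add] at h
  rw [← h]
  refine Finset.prod_congr rfl fun i _ => ?_
  linear_combination (-(p i * p (i + 1 + 1))) * hp (i + 1)

/-- There is no negacyclic Hadamard matrix of order at least `3`; only the orthogonality of the
first three rows is used. -/
theorem no_negacyclic_hadamard (p : ℕ → ℤ) (hp : ∀ i, p i * p i = 1) (m : ℕ)
    (hneg : ∀ i, p (i + m) = -p i)
    (h1 : ∑ i ∈ Finset.range m, p i * p (i + 1) = 0)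
    (h2 : ∑ i ∈ Finset.range m, p i * p (i + 2) = 0) : False := by
  have hs : ∀ i j, (p i * p j) * (p i * p j) = 1 := fun i j => by
    linear_combination p j * p j * hp i + hp j
  -- The m products of the shift by 1 multiply to -1 and those of the shift by 2 to +1, so vanishing
  -- of both sums would make m both 2 and 0 modulo 4.
  have k1 := (four_dvd_sum_signs_sub (Finset.range m) _ fun i => hs i (i + 1)).2
  have k2 := (four_dvd_sum_signs_sub (Finset.range m) _ fun i => hs i (i + 2)).2
  rw [h1, prod_mul_succ_signs p hp] at k1
  rw [h2, prod_mul_add_two_signs p hp] at k2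
  have e0 := hneg 0
  have e1 := hneg 1
  rw [zero_add] at e0
  rw [add_comm] at e1
  have q1 : p 0 * p m = -1 := by rw [e0]; linear_combination -hp 0
  have q2 : p 0 * p 1 * (p m * p (m + 1)) = 1 := by rw [e0, e1]; linear_combination hs 0 1
  rw [q1] at k1
  rw [q2] at k2
  omega

theorem sum_range_two_mul {R : Type*} [AddCommMonoid R] (f : ℕ → R) (t : ℕ) :
    ∑ i ∈ Finset.range (2 * t), f i = ∑ i ∈ Finset.range t, (f (2 * i) + f (2 * i + 1)) := by
  induction t with
  | zero => simp
  | succ t ih =>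
    rw [Finset.sum_range_succ, ← ih, mul_add, mul_one, Finset.sum_range_succ,
      Finset.sum_range_succ, add_assoc]

/-- The sum of a function of period `m` over `m` consecutive integers. -/
theorem sum_range_add_of_periodic (f : ℕ → ℤ) (m : ℕ) (hf : ∀ i, f (i + m) = f i) (k : ℕ) :
    ∑ i ∈ Finset.range m, f (i + k) = ∑ i ∈ Finset.range m, f i := by
  induction k with
  | zero => simp
  | succ k ih =>
    rw [← ih]
    have h1 := Finset.sum_range_succ (fun i => f (i + k)) m
    have h2 := Finset.sum_range_succ' (fun i => f (i + k)) m
    have h3 : f (m + k) = f (0 + k) := by rw [zero_add, add_comm, hf]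
    rw [h1, h3] at h2
    have h4 := add_right_cancel h2
    rw [h4]
    exact Finset.sum_congr rfl fun i _ => by congr 1; ring

/-! ### Translations that cannot act on F through a character -/

namespace IsOrthogonalSign

variable {M : Type*} [CommGroup M] {t : ℕ} {a b z : M} {F χ : M → ℤ} {c : ℤ}

/-- The generator `a` may be replaced by `a * b`. -/
theorem mul_left (h : IsOrthogonalSign (2 * t) a b F) : IsOrthogonalSign (2 * t) (a * b) b F := by
  have hb2 : b ^ 2 = 1 := by rw [pow_two, h.b_sq]
  have hb : ∀ k, (a * b) ^ k = a ^ k ∨ (a * b) ^ k = a ^ k * b := by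
    intro k
    rcases Nat.even_or_odd' k with ⟨r, rfl | rfl⟩
    · left; rw [mul_pow, pow_mul b, hb2, one_pow, mul_one]
    · right; rw [mul_pow, pow_succ b, pow_mul b, hb2, one_pow, one_mul]
  have hm : (a * b) ^ (2 * t) = a ^ (2 * t) := by
    rw [mul_pow, pow_mul b, hb2, one_pow, mul_one]
  refine ⟨h.sq, fun g => by rw [hm, h.neg], h.b_sq, ?_, ?_, ?_⟩
  · intro y h1 h2
    rw [hm] at h2
    rw [← h.orth y h1 h2]
    refine Finset.sum_congr rfl fun i _ => ?_
    rcases hb i with e | e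
    · rw [e]
    · rw [e, mul_assoc (a ^ i) b b, h.b_sq, mul_one, add_comm]
  · intro k h1 h2
    rw [hm]
    rcases hb k with e | e
    · rw [e]; exact h.pow_ne k h1 h2
    · rw [e]; exact h.pow_mul_ne k h2
  · intro k h2
    rw [hm]
    rcases Nat.even_or_odd' k with ⟨r, rfl | rfl⟩
    · rw [mul_pow, pow_mul b, hb2, one_pow, mul_one]; exact h.pow_mul_ne _ h2
    · rw [mul_pow, pow_succ b, pow_mul b, hb2, one_pow, one_mul, mul_assoc, h.b_sq, mul_one]
      exact h.pow_ne _ (by omega) h2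

theorem sum_pow (h : IsOrthogonalSign (2 * t) a b F) (k : ℕ) (hk : 0 < k) (hkt : k < 2 * t) :
    ∑ i ∈ Finset.range (2 * t),
      (F (a ^ i) * F (a ^ (i + k)) + F (a ^ i * b) * F (a ^ (i + k) * b)) = 0 := by
  rw [← h.orth (a ^ k) (h.pow_ne k hk hkt).1 (h.pow_ne k hk hkt).2]
  refine Finset.sum_congr rfl fun i _ => ?_
  rw [pow_add, mul_right_comm]

theorem sum_pow_mul (h : IsOrthogonalSign (2 * t) a b F) (k : ℕ) (hkt : k < 2 * t) :
    ∑ i ∈ Finset.range (2 * t),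
      (F (a ^ i) * F (a ^ (i + k) * b) + F (a ^ i * b) * F (a ^ (i + k))) = 0 := by
  rw [← h.orth (a ^ k * b) (h.pow_mul_ne k hkt).1 (h.pow_mul_ne k hkt).2]
  refine Finset.sum_congr rfl fun i _ => ?_
  rw [pow_add, mul_assoc, mul_assoc (a ^ i) b, mul_left_comm b, h.b_sq, mul_one]

theorem neg_pow (h : IsOrthogonalSign (2 * t) a b F) (i : ℕ) :
    F (a ^ (i + 2 * t)) = -F (a ^ i) := by
  rw [pow_add, h.neg]

theorem neg_pow_mul (h : IsOrthogonalSign (2 * t) a b F) (i : ℕ) :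
    F (a ^ (i + 2 * t) * b) = -F (a ^ i * b) := by
  rw [pow_add, mul_right_comm, h.neg]

theorem map_pow_of_mul (hχ : ∀ x y, χ (x * y) = χ x * χ y) (hs : ∀ x, χ x * χ x = 1) (i : ℕ) :
    χ (a ^ i) = χ a ^ i := by
  have h1 : χ 1 = 1 := by rw [← mul_one (1 : M), hχ, hs]
  induction i with
  | zero => simp [h1]
  | succ i ih => rw [pow_succ, hχ, ih, pow_succ]

/-- Translation by `b` does not multiply `F` by a character, up to a constant. -/
theorem not_translate_involution (h : IsOrthogonalSign (2 * t) a b F) (ht : 3 ≤ t)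
    (hc : c * c = 1) (hχ : ∀ x y, χ (x * y) = χ x * χ y) (hs : ∀ x, χ x * χ x = 1)
    (hb : ∀ g, F (g * b) = c * χ g * F g) : False := by
  have hp := map_pow_of_mul (a := a) hχ hs
  have hc0 : c ≠ 0 := by rintro rfl; simp at hc
  -- Orthogonality to the translate by a^(2k) b, with b eliminated and c cancelled.
  have hsum : ∀ k < t, ∑ i ∈ Finset.range (2 * t),
      χ a ^ i * (1 + χ a ^ (2 * k)) * (F (a ^ i) * F (a ^ (i + 2 * k))) = 0 := by
    intro k hk
    have := h.sum_pow_mul (2 * k) (by omega)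
    simp only [hb, hp] at this
    have h2 : c * ∑ i ∈ Finset.range (2 * t),
        χ a ^ i * (1 + χ a ^ (2 * k)) * (F (a ^ i) * F (a ^ (i + 2 * k))) = 0 := by
      rw [← this, Finset.mul_sum]
      refine Finset.sum_congr rfl fun i _ => ?_
      rw [pow_add]; ring
    exact (mul_eq_zero.mp h2).resolve_left hc0
  rcases Int.eq_one_or_neg_one_of_mul_self (hs a) with ha | ha
  -- For k = 0 and χ(a) = 1 every term equals 2, so the sum is 4t.
  · have := hsum 0 (by omega)
    simp [ha, h.sq] at this
    omega
  -- For χ(a) = -1, `hsum` gives even terms minus odd terms and `sum_pow` gives even plus odd. Hence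
  -- the even terms alone sum to zero, and F(a^(2i)) is negacyclic of length t.
  · have key : ∀ k, 0 < k → k < t →
        ∑ i ∈ Finset.range t, F (a ^ (2 * i)) * F (a ^ (2 * (i + k))) = 0 := by
      intro k hk hkt
      have h1 := hsum k hkt
      have h2 := h.sum_pow (2 * k) (by omega) (by omega)
      simp only [hb, hp] at h2
      rw [sum_range_two_mul] at h1 h2
      simp only [ha, pow_add, pow_mul, neg_one_sq, one_pow, pow_one, one_mul] at h1 h2
      have h3 := congrArg₂ (· + ·) h1 h2
      simp only [← Finset.sum_add_distrib, add_zero] at h3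
      have h4 : (4 : ℤ) * ∑ i ∈ Finset.range t, F (a ^ (2 * i)) * F (a ^ (2 * (i + k))) = 0 := by
        rw [← h3, Finset.mul_sum]
        refine Finset.sum_congr rfl fun i _ => ?_
        simp only [mul_add, pow_add, pow_mul]
        linear_combination (-(F ((a ^ 2) ^ i) * F ((a ^ 2) ^ i * (a ^ 2) ^ k)) -
          F ((a ^ 2) ^ i * a) * F ((a ^ 2) ^ i * a * (a ^ 2) ^ k)) * hc
      omega
    exact no_negacyclic_hadamard (fun i => F (a ^ (2 * i))) (fun i => h.sq _) t
      (fun i => by rw [mul_add, h.neg_pow]) (key 1 (by omega) (by omega))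
      (key 2 (by omega) (by omega))

/-- Translation by an element `z` with `z * z = a ^ (2 * t)` does not multiply `F` by a constant
times a character which is trivial on `a` and not on `b`. -/
theorem not_translate_of_map_eq_one (h : IsOrthogonalSign (2 * t) a b F) (ht : 3 ≤ t)
    (hc : c * c = 1) (hp : ∀ i, χ (a ^ i) = 1)
    (hz : ∀ g, F (g * (a ^ t * b)) = c * χ g * F g) : False := by
  have hB : ∀ i, F (a ^ (i + t) * b) = c * F (a ^ i) := fun i => by
    rw [pow_add, mul_assoc, hz, hp, mul_one]
  have key : ∀ k, 0 < k → k < 2 * t →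
      ∑ i ∈ Finset.range (2 * t), F (a ^ i) * F (a ^ (i + k)) = 0 := by
    intro k hk hkt
    have h1 := h.sum_pow k hk hkt
    -- The sequence on the coset of b is, up to c, the first one delayed by t. Its autocorrelation
    -- has period 2t, so it may be summed from t on and then equals that of the first sequence.
    rw [Finset.sum_add_distrib,
      ← sum_range_add_of_periodic (fun i => F (a ^ i * b) * F (a ^ (i + k) * b)) (2 * t)
        (fun i => by rw [h.neg_pow_mul, add_right_comm, h.neg_pow_mul, neg_mul_neg]) t,
      ← Finset.sum_add_distrib] at h1
    have h2 : (2 : ℤ) * ∑ i ∈ Finset.range (2 * t), F (a ^ i) * F (a ^ (i + k)) = 0 := by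
      rw [← h1, Finset.mul_sum]
      refine Finset.sum_congr rfl fun i _ => ?_
      rw [hB, add_right_comm, hB]
      linear_combination (-(F (a ^ i) * F (a ^ (i + k)))) * hc
    omega
  exact no_negacyclic_hadamard (fun i => F (a ^ i)) (fun i => h.sq _) (2 * t)
    h.neg_pow (key 1 (by omega) (by omega)) (key 2 (by omega) (by omega))

/-- For `t` odd, translation by `a ^ t` or `a ^ t * b` does not multiply `F` by a constant times
the character with value `-1` on `a` and `1` on `b`. -/
theorem not_translate_of_odd (h : IsOrthogonalSign (2 * t) a b F) (ht : 2 ≤ t) (hodd : Odd t)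
    (hc : c * c = 1) (hp : ∀ i, χ (a ^ i) = (-1) ^ i) (hpb : ∀ i, χ (a ^ i * b) = (-1) ^ i)
    (hz : (∀ g, F (g * a ^ t) = c * χ g * F g) ∨ ∀ g, F (g * (a ^ t * b)) = c * χ g * F g) :
    False := by
  have hAB : ((∀ i, F (a ^ (t + i)) = c * (-1) ^ i * F (a ^ i)) ∧
        ∀ i, F (a ^ (t + i) * b) = c * (-1) ^ i * F (a ^ i * b)) ∨
      ((∀ i, F (a ^ (t + i)) = c * (-1) ^ i * F (a ^ i * b)) ∧
        ∀ i, F (a ^ (t + i) * b) = c * (-1) ^ i * F (a ^ i)) := by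
    rcases hz with hz | hz
    · refine Or.inl ⟨fun i => ?_, fun i => ?_⟩
      · rw [← hp, ← hz, add_comm, pow_add]
      · rw [← hpb, ← hz, add_comm, pow_add, mul_right_comm]
    · refine Or.inr ⟨fun i => ?_, fun i => ?_⟩
      · rw [← hpb, ← hz, add_comm, pow_add, mul_mul_mul_comm, h.b_sq, mul_one]
      · rw [← hp, ← hz, add_comm, pow_add, mul_assoc]
  have hsq : ∀ i : ℕ, ((-1 : ℤ) ^ i) * (-1) ^ i = 1 := fun i => by
    rw [← mul_pow]; norm_num
  -- A shift by 2 preserves the factor c (-1)^i, so the terms with i ≥ t repeat those with i < t,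
  -- possibly with the two sequences exchanged.
  have hsum : ∑ i ∈ Finset.range t,
      (F (a ^ i) * F (a ^ (i + 2)) + F (a ^ i * b) * F (a ^ (i + 2) * b)) = 0 := by
    have h1 := h.sum_pow 2 (by omega) (by omega)
    rw [two_mul t, Finset.sum_range_add, ← Finset.sum_add_distrib] at h1
    have h2 : (2 : ℤ) * ∑ i ∈ Finset.range t,
        (F (a ^ i) * F (a ^ (i + 2)) + F (a ^ i * b) * F (a ^ (i + 2) * b)) = 0 := by
      rw [← h1, Finset.mul_sum]
      refine Finset.sum_congr rfl fun i _ => ?_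
      have e : c * (-1) ^ i * (c * (-1) ^ (i + 2)) = 1 := by
        rw [pow_add]; linear_combination (-1) ^ i * (-1) ^ i * hc + hsq i
      rcases hAB with ⟨h3, h4⟩ | ⟨h3, h4⟩ <;> rw [add_assoc t, h3, h3, h4, h4] <;>
        linear_combination (-(F (a ^ i) * F (a ^ (i + 2)) +
          F (a ^ i * b) * F (a ^ (i + 2) * b))) * e
    omega
  have hs : ∀ x y, (F x * F y) * (F x * F y) = 1 := fun x y => by
    linear_combination F y * F y * h.sq x + h.sq y
  obtain ⟨k1, k2⟩ := four_dvd_sum_signs_sub (Finset.range t) _ fun i => hs (a ^ i) (a ^ (i + 2))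
  have k3 := (four_dvd_sum_signs_sub (Finset.range t) _
    fun i => hs (a ^ i * b) (a ^ (i + 2) * b)).2
  -- After telescoping, each of the factors c and -c occurs once for each sequence, so everything is
  -- squared.
  have hprod : (∏ i ∈ Finset.range t, F (a ^ i) * F (a ^ (i + 2))) *
      ∏ i ∈ Finset.range t, F (a ^ i * b) * F (a ^ (i + 2) * b) = 1 := by
    rw [prod_mul_add_two_signs (fun i => F (a ^ i)) (fun i => h.sq _),
      prod_mul_add_two_signs (fun i => F (a ^ i * b)) (fun i => h.sq _)]
    have q := congrArg₂ (· * ·) (hs (a ^ 0) (a ^ 1)) (hs (a ^ 0 * b) (a ^ 1 * b))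
    rcases hAB with ⟨h3, h4⟩ | ⟨h3, h4⟩ <;> rw [h3 1, h4 1, ← add_zero t, h3 0, h4 0] <;>
      linear_combination (c * c + 1) * (F (a ^ 0) * F (a ^ 1) * (F (a ^ 0) * F (a ^ 1)) *
        (F (a ^ 0 * b) * F (a ^ 1 * b) * (F (a ^ 0 * b) * F (a ^ 1 * b)))) * hc + q
  rw [Finset.sum_add_distrib] at hsum
  rw [Finset.card_range] at k2 k3
  -- With common product e = ±1 the total is 2(t - 1 + e) modulo 4, which is 2 for t odd.
  obtain ⟨r, hr⟩ := hodd
  rcases Int.eq_one_or_neg_one_of_mul_self k1 with e | e <;> rw [e] at hprod k2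
  · rw [one_mul] at hprod
    rw [hprod] at k3
    omega
  · have e' : ∏ i ∈ Finset.range t, F (a ^ i * b) * F (a ^ (i + 2) * b) = -1 := by linarith
    rw [e'] at k3
    omega

/-- Translation by `a ^ t` or `a ^ t * b` does not multiply `F` by a character, up to a
constant. -/
theorem not_translate_square_root (h : IsOrthogonalSign (2 * t) a b F) (ht : 3 ≤ t)
    (hc : c * c = 1) (hχ : ∀ x y, χ (x * y) = χ x * χ y) (hs : ∀ x, χ x * χ x = 1)
    (hz : ∀ g, F (g * z) = c * χ g * F g) (hzt : z = a ^ t ∨ z = a ^ t * b) : False := by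
  have hzz : z * z = a ^ (2 * t) := by
    rcases hzt with rfl | rfl
    · rw [← pow_add, two_mul]
    · rw [mul_mul_mul_comm, h.b_sq, mul_one, ← pow_add, two_mul]
  -- Translating twice by z multiplies F(1) by c² χ(z) = χ(z); translating by u negates it.
  have hχz : χ z = -1 := by
    have h1 := h.neg 1
    rw [one_mul, ← hzz, hz] at h1
    have h2 := hz 1
    rw [one_mul] at h2
    rw [h2] at h1
    have h3 := hs 1
    have h4 := hχ 1 1
    rw [one_mul, h3] at h4
    rw [h4] at h1
    linear_combination F 1 * h1 - χ z * h.sq 1 * c * c - χ z * hc - h.sq 1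
  have hp : ∀ {x : M} i, χ (x ^ i) = χ x ^ i := fun i => map_pow_of_mul hχ hs i
  rcases Int.eq_one_or_neg_one_of_mul_self (hs a) with ea | ea <;>
    rcases Int.eq_one_or_neg_one_of_mul_self (hs b) with eb | eb
  · rcases hzt with rfl | rfl <;> simp [hχ, hp, ea, eb] at hχz
  · rcases hzt with rfl | rfl
    · simp [hp, ea] at hχz
    · exact h.not_translate_of_map_eq_one ht hc (fun i => by simp [hp, ea]) hz
  · have hodd : Odd t := by
      by_contra hev
      rw [Nat.not_odd_iff_even] at hev
      rcases hzt with rfl | rfl <;> simp [hχ, hp, ea, eb, hev] at hχz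
    refine h.not_translate_of_odd (by omega) hodd hc (χ := χ) (fun i => by simp [hp, ea])
      (fun i => by simp [hχ, hp, ea, eb]) ?_
    rcases hzt with rfl | rfl
    · exact Or.inl hz
    · exact Or.inr hz
  -- Replacing a by ab makes the character trivial on the first generator and permutes {a^t, a^t b}.
  · have hab : χ (a * b) = 1 := by rw [hχ, ea, eb]; norm_num
    have hb2 : b ^ 2 = 1 := by rw [pow_two, h.b_sq]
    have hzt' : z = (a * b) ^ t ∨ z = (a * b) ^ t * b := by
      rcases Nat.even_or_odd' t with ⟨r, hr | hr⟩
      · rw [mul_pow, show b ^ t = 1 by rw [hr, pow_mul, hb2, one_pow], mul_one]; exact hzt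
      · rw [mul_pow, show b ^ t = b by rw [hr, pow_succ, pow_mul, hb2, one_pow, one_mul],
          mul_assoc, h.b_sq, mul_one]
        exact hzt.symm
    rcases hzt' with e | e
    · rw [e, hp, hab, one_pow] at hχz; norm_num at hχz
    · rw [e] at hz
      exact h.mul_left.not_translate_of_map_eq_one ht hc
        (fun i => by rw [hp, hab, one_pow]) hz

end IsOrthogonalSign

/-! ### Signs of binary words and balance of Hadamard codes -/

/-- The sign `(-1) ^ x`. -/
def bitSign (x : ZMod 2) : ℤ := if x = 0 then 1 else -1

theorem bitSign_add (x y : ZMod 2) : bitSign (x + y) = bitSign x * bitSign y := by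
  revert x y; decide

theorem bitSign_mul_self (x : ZMod 2) : bitSign x * bitSign x = 1 := by
  revert x; decide

theorem bitSign_one : bitSign 1 = -1 := by decide

theorem Matrix.IsHadamard.bitSign_binaryRow {n : ℕ} {H : Matrix (Fin n) (Fin n) ℤ}
    (hH : H.IsHadamard) (i k : Fin n) : bitSign (binaryRow H i k) = H i k := by
  have h := (Unitary.mem_iff.mp (hH.apply_mem i k)).1
  rw [star_trivial] at h
  rcases Int.eq_one_or_neg_one_of_mul_self h with h | h <;> simp [binaryRow, h, bitSign]

/-- Words of a Hadamard code containing `0`, other than `0` and the all-one word, are balanced. -/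
theorem IsHadamardCode.sum_bitSign {n : ℕ} {S : Set (Word n)} (hS : IsHadamardCode S)
    (h0 : (0 : Word n) ∈ S) {y : Word n} (hy : y ∈ S) (hy0 : y ≠ 0) (hy1 : y ≠ 1) :
    ∑ k, bitSign (y k) = 0 := by
  obtain ⟨H, hH, rfl⟩ := hS
  have hrow : ∀ {x : Word n} {i : Fin n}, x = binaryRow H i ∨ x = binaryRow H i + 1 →
      ∃ d : ZMod 2, x = binaryRow H i + fun _ => d := by
    rintro x i (h | h)
    · exact ⟨0, by rw [h]; exact (add_zero _).symm⟩
    · exact ⟨1, h⟩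
  obtain ⟨i, hi⟩ := h0
  obtain ⟨j, hj⟩ := hy
  obtain ⟨d, hd⟩ := hrow hi
  obtain ⟨e, he⟩ := hrow hj
  -- If 0 and y came from the same row, y would be constant.
  have hij : j ≠ i := by
    rintro rfl
    have hyc : y = fun _ => e + d := by
      funext k
      have h1 := congrFun hd k
      have h2 := congrFun he k
      simp only [Pi.add_apply, Pi.zero_apply] at h1 h2
      rw [h2]
      generalize binaryRow H j k = r at h1
      clear hd he h2 hi hj hrow
      revert d e r; decide
    have h01 : e + d = 0 ∨ e + d = 1 := by
      generalize e + d = r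
      revert r; decide
    rcases h01 with h | h <;> rw [h] at hyc
    · exact hy0 hyc
    · exact hy1 hyc
  have horth := congrFun (congrFun hH.mul_conjTranspose j) i
  simp only [Matrix.mul_apply, Matrix.conjTranspose_apply, star_trivial, Matrix.smul_apply,
    Matrix.one_apply_ne hij, smul_zero] at horth
  have hk : ∀ k, bitSign (y k) = bitSign e * bitSign d * (H j k * H i k) := by
    intro k
    have h1 := congrFun hd k
    have h2 := congrFun he k
    simp only [Pi.add_apply, Pi.zero_apply] at h1 h2
    rw [← hH.bitSign_binaryRow, ← hH.bitSign_binaryRow, h2]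
    generalize binaryRow H j k = r
    generalize binaryRow H i k = s at h1
    clear hd he h2 hi hj hrow
    revert d e r s; decide
  simp only [hk]
  rw [← Finset.mul_sum, horth, mul_zero]

theorem mem_codeKernel_iff {n : ℕ} {S : Set (Word n)} {z : Word n} :
    z ∈ codeKernel S ↔ ∀ x ∈ S, x + z ∈ S := by
  refine ⟨fun h x hx => ?_, fun h => ?_⟩
  · have h' : (fun x => x + z) '' S = S := h
    rw [← h']
    exact ⟨x, hx, rfl⟩
  · change (fun x => x + z) '' S = S
    refine Set.Subset.antisymm ?_ fun x hx => ⟨x + z, h x hx, ?_⟩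
    · rintro _ ⟨x, hx, rfl⟩
      exact h x hx
    · change x + z + z = x
      rw [add_assoc, ZModModule.add_self, add_zero]

/-! ### The kernel of a propelinear code as a subgroup -/

namespace PropelinearCode

variable {n : ℕ} (C : PropelinearCode n)

theorem mul_val (x y : C.carrier) : (x * y).1 = x.1 + Word.permute (C.π x) y.1 := rfl

theorem π_map_mul (x y : C.carrier) : C.π (x * y) = C.π x * C.π y := (C.π_mul x y).symm

theorem π_map_one : C.π 1 = 1 := C.π_zero

theorem π_map_inv (x : C.carrier) : C.π x⁻¹ = (C.π x)⁻¹ :=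
  eq_inv_of_mul_eq_one_left (by rw [← π_map_mul, inv_mul_cancel, π_map_one])

theorem mem_of_mem_codeKernel {z : Word n} (hz : z ∈ codeKernel C.carrier) : z ∈ C.carrier := by
  have h := mem_codeKernel_iff.mp hz 0 C.zero_mem
  rwa [zero_add] at h

/-- Any codeword w is x * (x⁻¹ * w), so w + π_x(z) = x + π_x(x⁻¹ * w + z), which is again a product
of codewords. -/
theorem permute_mem_codeKernel (x : C.carrier) {z : Word n} (hz : z ∈ codeKernel C.carrier) :
    Word.permute (C.π x) z ∈ codeKernel C.carrier := by
  rw [mem_codeKernel_iff]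
  intro w hw
  have h : w = x.1 + Word.permute (C.π x) (x⁻¹ * ⟨w, hw⟩).1 := by
    rw [← mul_val, mul_inv_cancel_left]
  rw [h, add_assoc, ← Word.permute_add]
  exact C.add_permute_mem x ⟨_, mem_codeKernel_iff.mp hz _ (x⁻¹ * ⟨w, hw⟩).2⟩

/-- The kernel of a propelinear code, as a subgroup. -/
def kernelSubgroup : Subgroup C.carrier where
  carrier := {x | x.1 ∈ codeKernel C.carrier}
  one_mem' := (codeKernel C.carrier).zero_mem
  mul_mem' {x y} hx hy := (codeKernel C.carrier).add_mem hx (C.permute_mem_codeKernel x hy)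
  inv_mem' {x} hx := by
    have h := C.permute_mem_codeKernel x⁻¹ hx
    rwa [π_map_inv] at h

theorem card_kernelSubgroup :
    Nat.card C.kernelSubgroup = 2 ^ Module.finrank (ZMod 2) (codeKernel C.carrier) := by
  have e : C.kernelSubgroup ≃ codeKernel C.carrier :=
    { toFun := fun x => ⟨x.1.1, x.2⟩
      invFun := fun z => ⟨⟨z.1, C.mem_of_mem_codeKernel z.2⟩, z.2⟩
      left_inv := fun _ => rfl
      right_inv := fun _ => rfl }
  rw [Nat.card_congr e, Module.natCard_eq_pow_finrank (K := ZMod 2), Nat.card_zmod]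

/-- A kernel with an element outside the subgroup `N` has an element outside `N` whose square is
in `N`. -/
theorem exists_mul_self_mem {N : Subgroup C.carrier} {w : C.carrier}
    (hw : w ∈ C.kernelSubgroup) (hwN : w ∉ N) :
    ∃ z ∈ C.kernelSubgroup, z ∉ N ∧ z * z ∈ N := by
  -- Repeated squaring reaches 1, which lies in N; the last power outside N is the required element.
  have key : ∀ (s : ℕ) (z : C.carrier), z ∈ C.kernelSubgroup → z ∉ N → z ^ 2 ^ s = 1 →
      ∃ z ∈ C.kernelSubgroup, z ∉ N ∧ z * z ∈ N := by
    intro s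
    induction s with
    | zero =>
      intro z _ hzN h
      rw [pow_zero, pow_one] at h
      exact absurd (h ▸ N.one_mem) hzN
    | succ s ih =>
      intro z hz hzN h
      by_cases hzz : z * z ∈ N
      · exact ⟨z, hz, hzN, hzz⟩
      · exact ih (z * z) (mul_mem hz hz) hzz (by rw [← pow_two, ← pow_mul, ← pow_succ', h])
  refine key (Module.finrank (ZMod 2) (codeKernel C.carrier)) w hw hwN ?_
  have h := pow_card_eq_one' (x := (⟨w, hw⟩ : C.kernelSubgroup))
  rw [card_kernelSubgroup] at h
  simpa using congrArg Subtype.val h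

/-- In a commutative propelinear code, if `z` is in the kernel and `z * z` is a constant word, then
the images of `z` under the permutations of the code have the same square as `z`. -/
theorem permute_mul_self (hcomm : ∀ x y : C.carrier, x * y = y * x) {z h x : C.carrier}
    (hv : ∀ σ, Word.permute σ (z * z).1 = (z * z).1) (hh : h.1 = Word.permute (C.π x) z.1) :
    h * h = z * z := by
  have hπ : ∀ x y : C.carrier, ∀ w : Word n, Word.permute (C.π x) (Word.permute (C.π y) w) =
      Word.permute (C.π y) (Word.permute (C.π x) w) := by
    intro x y w
    rw [← Word.permute_mul, ← Word.permute_mul, ← π_map_mul, ← π_map_mul, hcomm]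
  -- Write v for the constant word z * z. Applying π_x to z + π_z(z) = v gives h + π_z(h) = v; then
  -- h * z = z * h gives π_h(z) = z + v, and π_x turns this into π_h(h) = h + v.
  have h1 := hv (C.π x)
  nth_rw 1 [mul_val] at h1
  rw [Word.permute_add, hπ, ← hh] at h1
  have h2 : (h * z).1 = (z * h).1 := by rw [hcomm]
  rw [mul_val, mul_val] at h2
  have hz2 : ∀ w : Word n, w + w = 0 := ZModModule.add_self
  have h3 : Word.permute (C.π h) z.1 = z.1 + (z * z).1 := by
    rw [← h1]
    calc Word.permute (C.π h) z.1 = h.1 + h.1 + Word.permute (C.π h) z.1 := by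
          rw [hz2, zero_add]
      _ = h.1 + (h.1 + Word.permute (C.π h) z.1) := add_assoc _ _ _
      _ = _ := by rw [h2]; abel
  apply Subtype.ext
  rw [C.mul_val h h]
  have h4 : Word.permute (C.π h) h.1 = h.1 + (z * z).1 := by
    rw [hh, hπ, h3, Word.permute_add, hv]
  rw [h4, ← add_assoc, hz2, zero_add]

/-- Trades the coordinate π_g⁻¹(k) of y for the fixed coordinate k of g and g * y, so that balance
of y becomes a correlation of F. -/
theorem bitSign_mul_apply (g y : C.carrier) (k : Fin n) :
    bitSign (y.1 ((C.π g)⁻¹ k)) = bitSign (g.1 k) * bitSign ((g * y).1 k) := by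
  rw [mul_val, Pi.add_apply, bitSign_add, ← mul_assoc, bitSign_mul_self, one_mul]
  rfl

end PropelinearCode

/-! ### The group C_N × C_2 and the passage from codes to orthogonal signs -/

/-- Two powers of the first generator of `C_N × C_2`. -/
theorem pow_ofAdd_one_eq_iff {N : ℕ} {i j : ℕ} :
    ((Multiplicative.ofAdd 1, 1) : Multiplicative (ZMod N) × Multiplicative (ZMod 2)) ^ i =
      (Multiplicative.ofAdd 1, 1) ^ j ↔ i ≡ j [MOD N] := by
  rw [pow_eq_pow_iff_modEq, Prod.orderOf_mk, orderOf_one, orderOf_ofAdd_eq_addOrderOf,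
    ZMod.addOrderOf_one, Nat.lcm_one_right]

theorem pow_ofAdd_one_mul_ne {N : ℕ} (i j : ℕ) :
    ((Multiplicative.ofAdd 1, 1) : Multiplicative (ZMod N) × Multiplicative (ZMod 2)) ^ i *
      (1, Multiplicative.ofAdd 1) ≠ (Multiplicative.ofAdd 1, 1) ^ j := by
  intro h
  have h2 := congrArg Prod.snd h
  simp only [Prod.snd_mul, Prod.pow_snd, one_pow, one_mul] at h2
  exact absurd h2 (by decide)

theorem exists_eq_pow_ofAdd_one {N : ℕ} (hN : 0 < N)
    (x : Multiplicative (ZMod N) × Multiplicative (ZMod 2)) : ∃ i < N,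
      x = (Multiplicative.ofAdd 1, 1) ^ i ∨
        x = (Multiplicative.ofAdd 1, 1) ^ i * (1, Multiplicative.ofAdd 1) := by
  have : NeZero N := ⟨hN.ne'⟩
  obtain ⟨x, y⟩ := x
  refine ⟨(Multiplicative.toAdd x).val, ZMod.val_lt _, ?_⟩
  have hx : (Multiplicative.ofAdd (1 : ZMod N)) ^ (Multiplicative.toAdd x).val = x := by
    rw [← ofAdd_nsmul, nsmul_one, ZMod.natCast_zmod_val, ofAdd_toAdd]
  have hy : y = 1 ∨ y = Multiplicative.ofAdd 1 := by revert y; decide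
  rcases hy with rfl | rfl
  · left; ext1 <;> simp [hx]
  · right; ext1 <;> simp [hx]

namespace PropelinearCode.IsHFP4tu2

variable {t : ℕ} {C : PropelinearCode (4 * t)}

theorem isOrthogonalSign (ht : 0 < t) (hC : C.IsHFP4tu2 t)
    (φ : Multiplicative (ZMod (4 * t)) × Multiplicative (ZMod 2) ≃* C.carrier)
    (hφ : (φ (Multiplicative.ofAdd 1, 1) ^ (2 * t)).1 = (1 : Word (4 * t))) (k : Fin (4 * t)) :
    IsOrthogonalSign (2 * t) (Multiplicative.ofAdd 1, 1) (1, Multiplicative.ofAdd 1)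
      (fun g => bitSign ((φ g).1 k)) := by
  set a : Multiplicative (ZMod (4 * t)) × Multiplicative (ZMod 2) := (Multiplicative.ofAdd 1, 1)
    with ha
  set b : Multiplicative (ZMod (4 * t)) × Multiplicative (ZMod 2) := (1, Multiplicative.ofAdd 1)
    with hb
  rw [← map_pow] at hφ
  have hpow : ∀ i j : ℕ, a ^ i = a ^ j ↔ i ≡ j [MOD 4 * t] := fun i j => pow_ofAdd_one_eq_iff
  have hbne : ∀ i j : ℕ, a ^ i * b ≠ a ^ j := fun i j => pow_ofAdd_one_mul_ne i j
  have hb2 : b * b = 1 := by exact Prod.ext (mul_one _) (ZModModule.add_self (1 : ZMod 2))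
  have hone : ∀ g, (φ g).1 = 1 → g = a ^ (2 * t) := fun g hg =>
    φ.injective (Subtype.ext (hg.trans hφ.symm))
  have hzero : ∀ g, (φ g).1 = 0 → g = 1 := fun g hg =>
    φ.injective (Subtype.ext (by rw [hg, map_one]; rfl))
  -- If g and h send k to the same place, π of h g⁻¹ fixes k, so h g⁻¹ is 1 or u.
  have hinj : ∀ g h, (C.π (φ g))⁻¹ k = (C.π (φ h))⁻¹ k → h = g ∨ h = g * a ^ (2 * t) := by
    intro g h hgh
    have hfix : C.π (φ (h * g⁻¹)) k = k := by
      rw [map_mul, map_inv, C.π_map_mul, C.π_map_inv, Equiv.Perm.mul_apply, hgh]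
      exact (C.π (φ h)).apply_symm_apply k
    by_cases h0 : (φ (h * g⁻¹)).1 = 0
    · left; exact mul_inv_eq_one.mp (hzero _ h0)
    by_cases h1 : (φ (h * g⁻¹)).1 = 1
    · right; rw [mul_comm g]; exact mul_inv_eq_iff_eq_mul.mp (hone _ h1)
    exact absurd hfix (hC.no_fixed _ h0 h1 k)
  refine ⟨fun g => bitSign_mul_self _, ?_, hb2, ?_, ?_, ?_⟩
  · intro g
    rw [mul_comm g, map_mul, C.mul_val, hφ, hC.eq_one _ (Or.inr hφ), Word.permute_one, Pi.add_apply,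
      bitSign_add, Pi.one_apply, bitSign_one, neg_one_mul]
  · intro y hy1 hyu
    have hbal := hC.hadamard.sum_bitSign C.zero_mem (φ y).2 (fun h => hy1 (hzero _ h))
      (fun h => hyu (hone _ h))
    -- The transversal has 4t elements, as many as there are coordinates, so injectivity suffices.
    let e : Fin (2 * t) ⊕ Fin (2 * t) → Fin (4 * t) := Sum.elim
      (fun i => (C.π (φ (a ^ i.1)))⁻¹ k) (fun i => (C.π (φ (a ^ i.1 * b)))⁻¹ k)
    have hpp : ∀ i j : Fin (2 * t), (a ^ j.1 = a ^ i.1 ∨ a ^ j.1 = a ^ i.1 * a ^ (2 * t)) →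
        i = j := by
      intro i j h
      rw [← pow_add, hpow, hpow] at h
      have hi := i.2
      have hj := j.2
      ext
      rcases h with h | h
      · rw [Nat.ModEq, Nat.mod_eq_of_lt (by omega), Nat.mod_eq_of_lt (by omega)] at h
        exact h.symm
      · rw [Nat.ModEq, Nat.mod_eq_of_lt (by omega), Nat.mod_eq_of_lt (by omega)] at h
        omega
    have he : Function.Bijective e := by
      rw [Fintype.bijective_iff_injective_and_card]
      refine ⟨?_, by simp; ring⟩
      rintro (i | i) (j | j) h
      · exact congrArg _ (hpp i j (hinj _ _ h))
      · rcases hinj _ _ h with h | h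
        · exact absurd h (hbne _ _)
        · rw [← pow_add] at h; exact absurd h (hbne _ _)
      · rcases hinj _ _ h.symm with h | h
        · exact absurd h (hbne _ _)
        · rw [← pow_add] at h; exact absurd h (hbne _ _)
      · refine congrArg _ (hpp i j ((hinj _ _ h).imp mul_right_cancel fun h => ?_))
        rw [mul_right_comm] at h
        exact mul_right_cancel h
    rw [← he.sum_comp, Fintype.sum_sum_type] at hbal
    simp only [e, Sum.elim_inl, Sum.elim_inr, C.bitSign_mul_apply, ← map_mul] at hbal
    rw [Finset.sum_add_distrib, ← Fin.sum_univ_eq_sum_range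
      (fun i => bitSign ((φ (a ^ i)).1 k) * bitSign ((φ (a ^ i * y)).1 k)),
      ← Fin.sum_univ_eq_sum_range
      (fun i => bitSign ((φ (a ^ i * b)).1 k) * bitSign ((φ (a ^ i * b * y)).1 k))]
    exact hbal
  · intro i hi hit
    rw [← pow_zero a, Ne, Ne, hpow, hpow, Nat.ModEq, Nat.ModEq, Nat.mod_eq_of_lt (by omega),
      Nat.mod_eq_of_lt (by omega), Nat.mod_eq_of_lt (by omega)]
    omega
  · intro i _
    exact ⟨by rw [← pow_zero a]; exact hbne _ _, hbne _ _⟩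

end PropelinearCode.IsHFP4tu2

/-! ### Square roots of 1 and u -/

theorem Subgroup.mem_zpowers_iff_of_mul_self {G : Type*} [Group G] {u x : G} (hu : u * u = 1) :
    x ∈ Subgroup.zpowers u ↔ x = 1 ∨ x = u := by
  rw [Subgroup.mem_zpowers_iff]
  constructor
  · rintro ⟨k, rfl⟩
    have hu2 : u ^ (2 : ℤ) = 1 := by rw [zpow_two, hu]
    rcases Int.even_or_odd' k with ⟨r, rfl | rfl⟩
    · left; rw [zpow_mul, hu2, one_zpow]
    · right; rw [zpow_add, zpow_mul, hu2, one_zpow, one_mul, zpow_one]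
  · rintro (rfl | rfl)
    · exact ⟨0, zpow_zero u⟩
    · exact ⟨1, zpow_one x⟩

/-- The square roots of `1` in `C_{4t} × C_2`. -/
theorem eq_of_mul_self_eq_one {t : ℕ} (ht : 0 < t)
    {x : Multiplicative (ZMod (4 * t)) × Multiplicative (ZMod 2)} (hx : x * x = 1) :
    (x = 1 ∨ x = (Multiplicative.ofAdd 1, 1) ^ (2 * t)) ∨
      (x = (1, Multiplicative.ofAdd 1) ∨
        x = (Multiplicative.ofAdd 1, 1) ^ (2 * t) * (1, Multiplicative.ofAdd 1)) := by
  obtain ⟨i, hi, hxi⟩ := exists_eq_pow_ofAdd_one (by omega) x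
  have hb : ((1, Multiplicative.ofAdd 1) : Multiplicative (ZMod (4 * t)) ×
      Multiplicative (ZMod 2)) * (1, Multiplicative.ofAdd 1) = 1 :=
    Prod.ext (mul_one _) (ZModModule.add_self (1 : ZMod 2))
  have h2 : (Multiplicative.ofAdd (1 : ZMod (4 * t)), (1 : Multiplicative (ZMod 2))) ^ (i + i) =
      (Multiplicative.ofAdd 1, 1) ^ 0 := by
    rw [pow_add, pow_zero, ← hx]
    rcases hxi with rfl | rfl
    · rfl
    · rw [mul_mul_mul_comm, hb, mul_one]
  rw [pow_ofAdd_one_eq_iff, Nat.modEq_zero_iff_dvd] at h2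
  have hi2 : i = 0 ∨ i = 2 * t := by
    obtain ⟨r, hr⟩ := h2
    have hr2 : r < 2 := by
      by_contra h
      have := Nat.mul_le_mul_left (4 * t) (not_lt.mp h)
      omega
    interval_cases r <;> omega
  rcases hi2 with rfl | rfl
  · rw [pow_zero, one_mul] at hxi; tauto
  · tauto

/-- The square roots of `a ^ (2 * t)` in `C_{4t} × C_2`. -/
theorem eq_of_mul_self_eq_pow {t : ℕ} (ht : 0 < t)
    {x : Multiplicative (ZMod (4 * t)) × Multiplicative (ZMod 2)}
    (hx : x * x = (Multiplicative.ofAdd 1, 1) ^ (2 * t)) :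
    (x = (Multiplicative.ofAdd 1, 1) ^ t ∨
        x = (Multiplicative.ofAdd 1, 1) ^ t * (1, Multiplicative.ofAdd 1)) ∨
      (x * (Multiplicative.ofAdd 1, 1) ^ (2 * t) = (Multiplicative.ofAdd 1, 1) ^ t ∨
        x * (Multiplicative.ofAdd 1, 1) ^ (2 * t) =
          (Multiplicative.ofAdd 1, 1) ^ t * (1, Multiplicative.ofAdd 1)) := by
  set a : Multiplicative (ZMod (4 * t)) × Multiplicative (ZMod 2) := (Multiplicative.ofAdd 1, 1)
    with ha
  have h4 : a ^ (2 * t) * a ^ (2 * t) = 1 := by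
    rw [← pow_add, ← pow_zero a, ha, pow_ofAdd_one_eq_iff, Nat.modEq_zero_iff_dvd]
    exact ⟨1, by ring⟩
  -- Two square roots of u differ by a square root of 1.
  have hsq : (x * (a ^ t)⁻¹) * (x * (a ^ t)⁻¹) = 1 := by
    rw [mul_mul_mul_comm, hx, ← mul_inv, ← pow_add, ← two_mul, mul_inv_cancel]
  rcases eq_of_mul_self_eq_one ht hsq with (h | h) | (h | h) <;> rw [mul_inv_eq_iff_eq_mul] at h
  · left; left; rw [h, one_mul]
  · right; left; rw [h, mul_right_comm, h4, one_mul]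
  · left; right; rw [h, mul_comm (a ^ t)]
  · right; right; rw [h, mul_right_comm, mul_right_comm _ _ (a ^ (2 * t)), h4, one_mul,
      mul_comm (a ^ t)]

/-! ### The character attached to z, and the main theorem -/

namespace PropelinearCode

variable {t : ℕ} {C : PropelinearCode (4 * t)}

/-- If the permutations of the code map `z` to itself or to its complement, then translation by
`z` multiplies the sign function of the code by a character, up to a constant. -/
theorem exists_translate_eq {M : Type*} [CommGroup M] (φ : M ≃* C.carrier) (k : Fin (4 * t))
    {z : M} (hz : ∀ g, Word.permute (C.π (φ g)) (φ z).1 = (φ z).1 ∨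
      Word.permute (C.π (φ g)) (φ z).1 = (φ z).1 + 1) :
    ∃ (c : ℤ) (χ : M → ℤ), c * c = 1 ∧ (∀ x y, χ (x * y) = χ x * χ y) ∧ (∀ x, χ x * χ x = 1) ∧
      ∀ g, bitSign ((φ (g * z)).1 k) = c * χ g * bitSign ((φ g).1 k) := by
  have hd : ∀ g, ∃ d : ZMod 2, Word.permute (C.π (φ g)) (φ z).1 = (φ z).1 + fun _ => d := by
    intro g
    rcases hz g with h | h
    · exact ⟨0, h.trans (add_zero _).symm⟩
    · exact ⟨1, h⟩
  choose d hd using hd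
  refine ⟨bitSign ((φ z).1 k), fun g => bitSign (d g), bitSign_mul_self _, fun x y => ?_,
    fun x => bitSign_mul_self _, fun g => ?_⟩
  · change bitSign (d (x * y)) = bitSign (d x) * bitSign (d y)
    rw [← bitSign_add]
    congr 1
    -- The constants add because π_{xy}(z) = π_x(π_y(z)) and constant words are fixed by
    -- permutations.
    have h := hd (x * y)
    rw [map_mul, C.π_map_mul, Word.permute_mul, hd y, Word.permute_add, hd x, add_assoc] at h
    exact (congrFun (add_left_cancel h) k).symm
  · rw [map_mul, C.mul_val, hd, Pi.add_apply, Pi.add_apply, bitSign_add, bitSign_add]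
    ring

end PropelinearCode

open PropelinearCode in
theorem mainTheorem2 (t : ℕ) (ht : 4 ≤ t) (C : PropelinearCode (4 * t)) (hC : C.IsHFP4tu2 t) :
    Module.finrank (ZMod 2) (codeKernel C.carrier) = 1 := by
  obtain ⟨φ, hφ⟩ := hC.groupType
  have hsign := hC.isOrthogonalSign (by omega) φ hφ ⟨0, by omega⟩
  rw [← map_pow] at hφ
  have hroot1 := fun {x} => eq_of_mul_self_eq_one (t := t) (by omega) (x := x)
  have hrootu := fun {x} => eq_of_mul_self_eq_pow (t := t) (by omega) (x := x)
  have h4 : (Multiplicative.ofAdd (1 : ZMod (4 * t)), (1 : Multiplicative (ZMod 2))) ^ (2 * t) *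
      (Multiplicative.ofAdd 1, 1) ^ (2 * t) = 1 := by
    rw [← pow_add, ← pow_zero (Multiplicative.ofAdd 1, 1), pow_ofAdd_one_eq_iff,
      Nat.modEq_zero_iff_dvd]
    exact ⟨1, by ring⟩
  generalize ((Multiplicative.ofAdd 1, 1) : Multiplicative (ZMod (4 * t)) ×
    Multiplicative (ZMod 2)) = a at *
  generalize ((1, Multiplicative.ofAdd 1) : Multiplicative (ZMod (4 * t)) ×
    Multiplicative (ZMod 2)) = b at *
  set u := a ^ (2 * t) with hu
  have hmulu : ∀ x, (φ (x * u)).1 = (φ x).1 + 1 := fun x => by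
    rw [map_mul, C.mul_val, hφ]; rfl
  have hone : ((1 : C.carrier)).1 = 0 := rfl
  have huK : u ∈ C.kernelSubgroup.comap φ.toMonoidHom := by
    refine mem_codeKernel_iff.mpr fun w hw => ?_
    change w + (φ u).1 ∈ _
    obtain ⟨x, hx⟩ := φ.surjective ⟨w, hw⟩
    have hx' : (φ x).1 = w := congrArg Subtype.val hx
    rw [hφ, ← hx', ← hmulu]
    exact (φ _).2
  have hu0 : (1 : Word (4 * t)) ≠ 0 := fun h => one_ne_zero (congrFun h ⟨0, by omega⟩)
  rw [finrank_eq_one_iff_of_nonzero' (⟨1, hφ ▸ huK⟩ : codeKernel C.carrier)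
    (fun h => hu0 (congrArg Subtype.val h))]
  rintro ⟨w, hw⟩
  by_contra hcon
  have hw0 : w ≠ 0 := by
    rintro rfl
    exact hcon ⟨0, Subtype.ext (zero_smul _ _)⟩
  have hw1 : w ≠ 1 := by
    rintro rfl
    exact hcon ⟨1, Subtype.ext (one_smul _ _)⟩
  have hmemN : ∀ {x}, φ x ∈ Subgroup.zpowers (φ u) ↔ x = 1 ∨ x = u := fun {x} => by
    rw [Subgroup.mem_zpowers_iff_of_mul_self (by rw [← map_mul, h4, map_one]), φ.injective.eq_iff,
      map_eq_one_iff φ φ.injective]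
  have hval : ∀ {x}, (x = 1 ∨ x = u) ↔ (φ x).1 = 0 ∨ (φ x).1 = 1 := fun {x} => by
    rw [← hone, ← hφ, Subtype.val_inj, Subtype.val_inj, φ.injective.eq_iff,
      map_eq_one_iff φ φ.injective]
  have hex : ∃ z, z ∈ C.kernelSubgroup.comap φ.toMonoidHom ∧ ¬(z = 1 ∨ z = u) ∧
      (z * z = 1 ∨ z * z = u) := by
    obtain ⟨x, hx⟩ := φ.surjective ⟨w, C.mem_of_mem_codeKernel hw⟩
    have hx' : (φ x).1 = w := congrArg Subtype.val hx
    obtain ⟨z, hz, hzN, hzz⟩ := C.exists_mul_self_mem (N := Subgroup.zpowers (φ u)) (w := φ x)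
      (by rw [hx]; exact hw) (by rw [hmemN, hval, hx', not_or]; exact ⟨hw0, hw1⟩)
    obtain ⟨z, rfl⟩ := φ.surjective z
    rw [← map_mul] at hzz
    exact ⟨z, hz, hmemN.not.mp hzN, hmemN.mp hzz⟩
  have horbit : ∀ z ∈ C.kernelSubgroup.comap φ.toMonoidHom, ¬(z = 1 ∨ z = u) →
      (z * z = 1 ∨ z * z = u) → ∀ g, ∃ h ∈ C.kernelSubgroup.comap φ.toMonoidHom,
        (φ h).1 = Word.permute (C.π (φ g)) (φ z).1 ∧ ¬(h = 1 ∨ h = u) ∧ h * h = z * z := by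
    intro z hz hz1 hzz g
    have hperm := C.permute_mem_codeKernel (φ g) (z := (φ z).1) hz
    obtain ⟨h, hh⟩ := φ.surjective ⟨_, C.mem_of_mem_codeKernel hperm⟩
    have hh' : (φ h).1 = Word.permute (C.π (φ g)) (φ z).1 := congrArg Subtype.val hh
    refine ⟨h, ?_, hh', ?_, φ.injective ?_⟩
    · change (φ h).1 ∈ codeKernel C.carrier
      rw [hh']; exact hperm
    · have hinv : (φ z).1 = Word.permute (C.π (φ g))⁻¹ (φ h).1 := by
        rw [hh', ← Word.permute_mul, inv_mul_cancel, Word.permute_one]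
      rw [hval] at hz1 ⊢
      rintro (e | e) <;> rw [e] at hinv
      · exact hz1 (Or.inl hinv)
      · exact hz1 (Or.inr hinv)
    · rw [map_mul, map_mul]
      refine C.permute_mul_self (x := φ g) (fun x y => ?_) (fun σ => ?_) hh'
      · obtain ⟨x, rfl⟩ := φ.surjective x
        obtain ⟨y, rfl⟩ := φ.surjective y
        rw [← map_mul, ← map_mul, mul_comm x]
      · rw [← map_mul]
        rcases hval.mp hzz with e | e <;> rw [e] <;> rfl
  have hbne : ¬(b = 1 ∨ b = u) := by
    have := hsign.pow_mul_ne 0 (by omega)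
    rw [pow_zero, one_mul] at this
    exact not_or.mpr this
  have hchar : ∀ {z}, (∀ g, ∃ h, (φ h).1 = Word.permute (C.π (φ g)) (φ z).1 ∧
      (h = z ∨ h = z * u)) → _ := fun {z} hz =>
    exists_translate_eq φ ⟨0, by omega⟩ (z := z) fun g => by
      obtain ⟨h, h1, rfl | rfl⟩ := hz g
      · exact Or.inl h1.symm
      · exact Or.inr (by rw [← h1, hmulu])
  -- If b is in the kernel, π_g(b) is a square root of 1 outside {1, u}, hence b or b u.
  by_cases hbK : b ∈ C.kernelSubgroup.comap φ.toMonoidHom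
  · obtain ⟨c, χ, hc, hχ, hs, hχb⟩ := hchar (z := b) fun g => by
      obtain ⟨h, -, h1, h2, h3⟩ := horbit b hbK hbne (Or.inl hsign.b_sq) g
      rw [hsign.b_sq] at h3
      rw [mul_comm b]
      exact ⟨h, h1, (hroot1 h3).resolve_left h2⟩
    exact hsign.not_translate_involution (by omega) hc hχ hs hχb
  -- Otherwise 1 and u are the only square roots of 1 in the kernel, so kernel elements with equal
  -- squares differ by 1 or u.
  · have hmul : ∀ {x}, x ∈ C.kernelSubgroup.comap φ.toMonoidHom → x * x = 1 → x = 1 ∨ x = u := by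
      intro x hx hxx
      refine (hroot1 hxx).resolve_right ?_
      rintro (rfl | rfl)
      · exact hbK hx
      · exact hbK ((Subgroup.mul_mem_cancel_left _ huK).mp hx)
    obtain ⟨z, hz, hz1, hzz⟩ := hex
    have hzu : z * z = u := hzz.resolve_left fun h => hz1 (hmul hz h)
    obtain ⟨c, χ, hc, hχ, hs, hχz⟩ := hchar (z := z) fun g => by
      obtain ⟨h, hK, h1, h2, h3⟩ := horbit z hz hz1 hzz g
      refine ⟨h, h1, ?_⟩
      rcases hmul (mul_mem hK (inv_mem hz))
        (by rw [mul_mul_mul_comm, h3, ← mul_inv, mul_inv_cancel]) with e | e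
      · exact Or.inl (mul_inv_eq_one.mp e)
      · right; rw [mul_comm z]; exact mul_inv_eq_iff_eq_mul.mp e
    rcases hrootu hzu with h | h
    · exact hsign.not_translate_square_root (by omega) hc hχ hs hχz h
    -- Here it is z u that equals a^t or a^t b; the factor u negates F, which turns c into -c.
    · refine hsign.not_translate_square_root (c := -c) (by omega) (by rw [neg_mul_neg, hc]) hχ hs
        (fun g => ?_) h
      rw [← mul_assoc, hsign.neg, hχz]
      ring
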